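/- Work on the circle $\mathbb T=\mathbb R/\mathbb Z$ with Lebesgue measure; $I$ denotes an arc of $\mathbb T$ and $|I|>0$ its length. A weight is an integrable function on $\mathbb T$ that is positive almost everywhere. A weight $w$ satisfies $A_p$ for $1<p<\infty$ if $$\sup_I\Big(\frac1{|I|}\int_I w\Big)\Big(\frac1{|I|}\int_I w^{-\frac1{p-1}}\Big)^{p-1}<\infty;$$ it satisfies $A_1$ if $Mw\le Cw$ almost everywhere for some constant $C$, where $M$ is the Hardy--Littlewood maximal operator $Mf(x)=\sup_{I\ni x}\frac1{|I|}\int_I|f|$; and it satisfies $A_\infty$ if it satisfies $A_p$ for some $p\in[1,\infty)$. A weight $w$ satisfies $\alpha_p$ for $1<p<2$ if $$\sup_I\Big(\frac1{|I|}\int_I w^{-\frac1{p-1}}\Big)^{p-1}\Big(\frac1{|I|}\int_I w^{\frac2{2-p}}\Big)^{\frac{2-p}2}<\infty,$$ it satisfies $\alpha_1$ if $w^2$ satisfies $A_1$, and it satisfies $\alpha_2$ if $w^{-1}$ satisfies $A_1$. Let $1\le q<2$, let $w$ be a weight on $\mathbb T$ satisfying $\alpha_q$, and let $a$ be a weight on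 $\mathbb T$ satisfying $A_\infty$. Then there exists $\delta$ with $0<\delta<1$ such that for every $t\in(1,1+\delta]$ there exists $r\in(t,2)$ such that $w^ta^{1-t}$ is a weight satisfying $\alpha_r$. -/

import Mathlib

open MeasureTheory
open scoped ENNReal NNReal

namespace CircleWeight

/-- The arc of the circle `ℝ / ℤ` that runs from the point `s` to the point `s'`; it is a genuine
arc when `s < s' ≤ s + 1` (`s' = s + 1` gives the whole circle). The endpoints have measure zero and
play no role in averages. -/
def arc (s s' : ℝ) : Set UnitAddCircle :=
  (fun x : ℝ => (x : UnitAddCircle)) '' Set.Ioc s s'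

/-- The family of all nondegenerate arcs of the circle. -/
def IsArc (I : Set UnitAddCircle) : Prop :=
  ∃ s s' : ℝ, s < s' ∧ s' ≤ s + 1 ∧ I = arc s s'

/-- The average `(1 / |I|) ∫_I f` of a nonnegative function, with value `∞` if `f` is not
integrable over `I`. -/
noncomputable def avg (I : Set UnitAddCircle) (f : UnitAddCircle → ℝ) : ℝ≥0∞ :=
  laverage (volume.restrict I) (fun x => ENNReal.ofReal (f x))

/-- The (uncentered) Hardy-Littlewood maximal function on the circle. -/
noncomputable def maximal (f : UnitAddCircle → ℝ) (x : UnitAddCircle) : ℝ≥0∞ :=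
  ⨆ (I : Set UnitAddCircle) (_ : IsArc I) (_ : x ∈ I), avg I (fun y => |f y|)

/-- A weight: an integrable function on the circle that is positive almost everywhere. -/
def IsWeight (w : UnitAddCircle → ℝ) : Prop :=
  Integrable w ∧ ∀ᵐ x, 0 < w x

/-- The Muckenhoupt condition `A_p`, `1 ≤ p < ∞`. -/
def SatisfiesA (p : ℝ) (w : UnitAddCircle → ℝ) : Prop :=
  IsWeight w ∧
    ((p = 1 ∧ ∃ C : ℝ≥0, ∀ᵐ x, maximal w x ≤ C * ENNReal.ofReal (w x)) ∨
     (1 < p ∧ ∃ C : ℝ≥0, ∀ I : Set UnitAddCircle, IsArc I →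
        avg I w * avg I (fun x => w x ^ (-(1 / (p - 1)))) ^ (p - 1) ≤ C))

/-- The condition `A_∞`: `A_p` for some finite `p`. -/
def SatisfiesAInfty (w : UnitAddCircle → ℝ) : Prop :=
  ∃ p : ℝ, SatisfiesA p w

/-- The condition `α_p`, `1 ≤ p ≤ 2`. -/
def SatisfiesAlpha (p : ℝ) (w : UnitAddCircle → ℝ) : Prop :=
  IsWeight w ∧
    ((p = 1 ∧ SatisfiesA 1 (fun x => w x ^ 2)) ∨
     (p = 2 ∧ SatisfiesA 1 (fun x => (w x)⁻¹)) ∨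
     (1 < p ∧ p < 2 ∧ ∃ C : ℝ≥0, ∀ I : Set UnitAddCircle, IsArc I →
        avg I (fun x => w x ^ (-(1 / (p - 1)))) ^ (p - 1) *
          avg I (fun x => w x ^ (2 / (2 - p))) ^ ((2 - p) / 2) ≤ C))

end CircleWeight

/-! Index power means by the reciprocal of the Lebesgue exponent. Then Hölder's inequality adds
indices, and passing from `f` to `f ^ c` with `c > 0` multiplies them by `c`. In this language `α_p`
with `1 < p < 2` is the two-sided condition with indices `(p - 1, (2 - p) / 2)`, and `A_∞` for `a`
gives `a⁻¹` the indices `(1, z)` for some `z > 0`. If `w` has indices `(p - 1, y)`, then `w ^ t * a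
^ (1 - t)` has indices `(t * p - 1, t * y + (t - 1) * z)`. With `r = t * p` the first index is
exactly the one in `α_r`, and `r > t` because `p > 1`. The second must be at most `(2 - t * p) / 2`.
This fails for every `t > 1` if `y = (2 - p) / 2`, but holds for `t` near `1` if `y` is strictly
smaller.

The strict gain is the self-improvement `TwoSided.exists_lt`, which rests on the reverse Hölder
inequality `exists_reverse_holder`. A Muckenhoupt condition forces a function to exceed a fixed
fraction `β` of its average on at least half of each interval. A stopping-time argument turns this
into a bound for the mass above level `l` by the measure of the set above `β * l`, and integration
over the levels raises the integrability exponent. For `q = 1` the first index is free, so after the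
gain there is room to take `p` slightly above `1`. -/

namespace CircleWeight

open Set Filter Topology

/-! ### Calderón–Zygmund stopping and the reverse Hölder inequality on an interval -/

/-- In every subinterval of `(u, v]`, at least half of the points satisfy
`g x > β * (average of g)`. -/
def HalfLarge (g : ℝ → ℝ≥0) (β : ℝ≥0) (u v : ℝ) : Prop :=
  ∀ a b, u ≤ a → a < b → b ≤ v → ENNReal.ofReal (b - a) ≤
    2 * volume (Ioc a b ∩ {x | (β : ℝ≥0∞) * ∫⁻ y in Ioc a b, g y < g x * ENNReal.ofReal (b - a)})

/-- Calderón–Zygmund stopping after `n` bisections of `(a, b]` at level `l`. -/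
theorem HalfLarge.exists_stopping_set {g : ℝ → ℝ≥0} {β : ℝ≥0} {u v : ℝ}
    (H : HalfLarge g β u v) (hg : Measurable g) (l : ℝ≥0) (n : ℕ) :
    ∀ a b, u ≤ a → a < b → b ≤ v → ∫⁻ y in Ioc a b, g y ≤ l * ENNReal.ofReal (b - a) →
      ∃ G, MeasurableSet G ∧ G ⊆ Ioc a b ∧
        ∫⁻ y in G, g y ≤ 4 * l * volume (Ioc a b ∩ {x | β * l < g x}) ∧
        ∀ x ∈ Ioc a b \ G, ∃ c d, c < x ∧ x ≤ d ∧ a ≤ c ∧ d ≤ b ∧ d - c = (b - a) / 2 ^ n ∧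
          ∫⁻ y in Ioc c d, g y ≤ l * ENNReal.ofReal (d - c) := by
  induction n with
  | zero =>
    intro a b _ _ _ h
    refine ⟨∅, MeasurableSet.empty, empty_subset _, by simp, fun x hx => ?_⟩
    exact ⟨a, b, hx.1.1, hx.1.2, le_rfl, le_rfl, by simp, h⟩
  | succ n ih =>
    intro a b hua hab hbv h
    -- On each half: if the average is still at most `l`, recurse; otherwise stop and select the
    -- whole half.
    have half : ∀ c d, a ≤ c → d ≤ b → d - c = (b - a) / 2 → ∃ G, MeasurableSet G ∧ G ⊆ Ioc c d ∧
        ∫⁻ y in G, g y ≤ 4 * l * volume (Ioc c d ∩ {x | β * l < g x}) ∧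
        ∀ x ∈ Ioc c d \ G, ∃ c' d', c' < x ∧ x ≤ d' ∧ a ≤ c' ∧ d' ≤ b ∧
          d' - c' = (b - a) / 2 ^ (n + 1) ∧
          ∫⁻ y in Ioc c' d', g y ≤ l * ENNReal.ofReal (d' - c') := by
      intro c d hac hdb hdc
      have hcd : c < d := by linarith
      by_cases hJ : ∫⁻ y in Ioc c d, g y ≤ l * ENNReal.ofReal (d - c)
      · obtain ⟨G, hGm, hGs, hGi, hG⟩ := ih c d (hua.trans hac) hcd (hdb.trans hbv) hJ
        refine ⟨G, hGm, hGs, hGi, fun x hx => ?_⟩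
        obtain ⟨c', d', h1, h2, h3, h4, h5, h6⟩ := hG x hx
        refine ⟨c', d', h1, h2, hac.trans h3, h4.trans hdb, ?_, h6⟩
        rw [h5, hdc, pow_succ]
        field_simp
      · push Not at hJ
        refine ⟨Ioc c d, measurableSet_Ioc, Subset.rfl, ?_, fun x hx => absurd hx.1 hx.2⟩
        -- The factor 4 is 2 from comparison with the parent, whose average is at most `l`, times 2
        -- from `HalfLarge`, which applies at level `β * l` because the average here exceeds `l`.
        calc ∫⁻ y in Ioc c d, (g y : ℝ≥0∞) ≤ ∫⁻ y in Ioc a b, g y :=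
              lintegral_mono_set (Ioc_subset_Ioc hac hdb)
          _ ≤ l * ENNReal.ofReal (b - a) := h
          _ = 2 * l * ENNReal.ofReal (d - c) := by
              rw [show b - a = 2 * (d - c) by linarith, ENNReal.ofReal_mul (by norm_num)]
              simp only [ENNReal.ofReal_ofNat]; ring
          _ ≤ 2 * l * (2 * volume (Ioc c d ∩ {x | β * l < g x})) := by
              gcongr
              refine (H c d (hua.trans hac) hcd (hdb.trans hbv)).trans (mul_le_mul' le_rfl ?_)
              refine measure_mono (inter_subset_inter_right _ fun x hx => ?_)
              simp only [mem_ofPred_eq] at hx ⊢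
              have h1 : (β : ℝ≥0∞) * (l * ENNReal.ofReal (d - c)) < g x * ENNReal.ofReal (d - c) :=
                lt_of_le_of_lt (by gcongr) hx
              rw [← mul_assoc] at h1
              have := lt_of_mul_lt_mul_right' h1
              exact_mod_cast this
          _ = _ := by ring
    set m := (a + b) / 2 with hm
    obtain ⟨G₁, hm₁, hs₁, hi₁, h₁⟩ := half a m le_rfl (by linarith) (by rw [hm]; ring)
    obtain ⟨G₂, hm₂, hs₂, hi₂, h₂⟩ := half m b (by linarith) le_rfl (by rw [hm]; ring)
    have hU : Ioc a m ∪ Ioc m b = Ioc a b := Ioc_union_Ioc_eq_Ioc (by linarith) (by linarith)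
    have hD : Disjoint (Ioc a m) (Ioc m b) := Ioc_disjoint_Ioc_of_le le_rfl
    refine ⟨G₁ ∪ G₂, hm₁.union hm₂, ?_, ?_, ?_⟩
    · rw [← hU]; exact union_subset_union hs₁ hs₂
    · rw [lintegral_union hm₂ (hD.mono hs₁ hs₂), ← hU, union_inter_distrib_right,
        measure_union (hD.mono inter_subset_left inter_subset_left), mul_add]
      · exact add_le_add hi₁ hi₂
      · exact measurableSet_Ioc.inter (measurableSet_lt measurable_const hg)
    · rintro x ⟨hx, hxG⟩
      rw [← hU] at hx
      rcases hx with hx | hx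
      · exact h₁ x ⟨hx, fun h => hxG (Or.inl h)⟩
      · exact h₂ x ⟨hx, fun h => hxG (Or.inr h)⟩

/-- Lebesgue differentiation along shrinking half-open intervals that contain the point. -/
theorem ae_le_of_frequently_average_le {g : ℝ → ℝ≥0} (hg : Measurable g) {u v : ℝ}
    (hfin : ∫⁻ y in Ioc u v, g y ≠ ∞) :
    ∀ᵐ x : ℝ, ∀ (l : ℝ≥0) (r : ℕ → ℝ), (∀ n, 0 < r n) → Tendsto r atTop (𝓝 0) →
      (∃ᶠ n in atTop, ∃ c d, c < x ∧ x ≤ d ∧ u ≤ c ∧ d ≤ v ∧ d - c = r n ∧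
        ∫⁻ y in Ioc c d, g y ≤ l * ENNReal.ofReal (d - c)) → g x ≤ l := by
  set h : ℝ → ℝ≥0∞ := (Ioc u v).indicator (fun y => (g y : ℝ≥0∞)) with hh
  have hhm : Measurable h := (measurable_coe_nnreal_ennreal.comp hg).indicator measurableSet_Ioc
  have hhi : ∫⁻ y, h y ≠ ∞ := by rwa [hh, lintegral_indicator measurableSet_Ioc]
  filter_upwards [(IsUnifLocDoublingMeasure.vitaliFamily (volume : Measure ℝ) 1).ae_tendsto_lintegral_div
    hhm.aemeasurable hhi] with x hx l r hr0 hr hfreq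
  obtain ⟨φ, hφ, hφp⟩ := extraction_of_frequently_atTop hfreq
  choose c d hcx hxd huc hdv hdc hle using hφp
  -- Up to an endpoint, `(c, d]` is the closed ball about its midpoint. It need not be centred at
  -- `x`; `K = 1` only asks that `x` lie in it.
  have ht := IsUnifLocDoublingMeasure.tendsto_closedBall_filterAt (μ := (volume : Measure ℝ))
    (K := 1) (x := x) (l := atTop) (fun k => (c k + d k) / 2) (fun k => (d k - c k) / 2) (by
      refine tendsto_nhdsWithin_iff.2 ⟨?_, Eventually.of_forall fun k => ?_⟩
      · have : Tendsto (fun k => r (φ k) / 2) atTop (𝓝 (0 / 2)) :=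
          (hr.comp hφ.tendsto_atTop).div_const 2
        simpa [hdc] using this
      · have := hr0 (φ k)
        simp only [mem_Ioi, hdc]; linarith) (Eventually.of_forall fun k => by
      rw [Real.closedBall_eq_Icc]
      constructor <;> linarith [hcx k, hxd k])
  have hlim := hx.comp ht
  have hxI : x ∈ Ioc u v := ⟨(huc 0).trans_lt (hcx 0), (hxd 0).trans (hdv 0)⟩
  have hval : h x = g x := by simp [hh, hxI]
  rw [hval] at hlim
  have : (g x : ℝ≥0∞) ≤ l := by
    refine le_of_tendsto' hlim fun k => ?_
    have hlt : c k < d k := (hcx k).trans_le (hxd k)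
    simp only [Function.comp]
    rw [Real.closedBall_eq_Icc, show (c k + d k) / 2 - (d k - c k) / 2 = c k by ring,
      show (c k + d k) / 2 + (d k - c k) / 2 = d k by ring,
      setLIntegral_congr Ioc_ae_eq_Icc.symm, Real.volume_Icc]
    refine ENNReal.div_le_of_le_mul ?_
    refine le_trans (le_of_eq ?_) (hle k)
    refine setLIntegral_congr_fun measurableSet_Ioc fun y hy => ?_
    have : y ∈ Ioc u v := Ioc_subset_Ioc (huc k) (hdv k) hy
    simp [hh, this]
  exact_mod_cast this

/-- The stopping sets `G n` obey the bound uniformly in `n`. A point outside infinitely many of them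
lies in arbitrarily short intervals of average at most `l`, so almost every point with `g > l` is
eventually in `G n`. Fatou's lemma then transfers the bound. -/
theorem HalfLarge.setLIntegral_superlevel_le {g : ℝ → ℝ≥0} {β : ℝ≥0} {u v : ℝ}
    (H : HalfLarge g β u v) (hg : Measurable g) (huv : u < v) (hfin : ∫⁻ y in Ioc u v, g y ≠ ∞)
    (l : ℝ≥0) (hl : ∫⁻ y in Ioc u v, g y ≤ l * ENNReal.ofReal (v - u)) :
    ∫⁻ y in Ioc u v ∩ {x | l < g x}, g y ≤ 4 * l * volume (Ioc u v ∩ {x | β * l < g x}) := by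
  choose G hGm hGs hGi hG using
    fun n => H.exists_stopping_set hg l n u v le_rfl huv le_rfl hl
  set S := Ioc u v ∩ {x | l < g x} with hS
  have hSm : MeasurableSet S := measurableSet_Ioc.inter (measurableSet_lt measurable_const hg)
  have hgm : Measurable fun y => (g y : ℝ≥0∞) := measurable_coe_nnreal_ennreal.comp hg
  have key : ∀ᵐ x, S.indicator (fun y => (g y : ℝ≥0∞)) x ≤
      liminf (fun n => (G n).indicator (fun y => (g y : ℝ≥0∞)) x) atTop := by
    filter_upwards [ae_le_of_frequently_average_le hg hfin] with x hx
    by_cases hxS : x ∈ S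
    · have hev : ∀ᶠ n in atTop, x ∈ G n := by
        by_contra hcon
        have hf : ∃ᶠ n in atTop, x ∉ G n := not_eventually.1 hcon
        refine absurd (hx l (fun n => (v - u) / 2 ^ n) (fun n => ?_) ?_ (hf.mono fun n hn => ?_))
          (not_le.2 hxS.2)
        · have : 0 < v - u := by linarith
          positivity
        · exact tendsto_const_nhds.div_atTop (tendsto_pow_atTop_atTop_of_one_lt (by norm_num))
        · exact hG n x ⟨hxS.1, hn⟩
      rw [indicator_of_mem hxS]
      refine le_liminf_of_le (by isBoundedDefault) ?_
      filter_upwards [hev] with n hn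
      rw [indicator_of_mem hn]
    · rw [indicator_of_notMem hxS]; exact zero_le
  calc ∫⁻ y in S, (g y : ℝ≥0∞) = ∫⁻ x, S.indicator (fun y => (g y : ℝ≥0∞)) x :=
        (lintegral_indicator hSm _).symm
    _ ≤ _ := lintegral_mono_ae key
    _ ≤ liminf (fun n => ∫⁻ x, (G n).indicator (fun y => (g y : ℝ≥0∞)) x) atTop :=
        lintegral_liminf_le fun n => hgm.indicator (hGm n)
    _ ≤ _ := by
        refine liminf_le_of_le (by isBoundedDefault) fun b hb => ?_
        obtain ⟨n, hn⟩ := hb.exists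
        refine hn.trans ?_
        rw [lintegral_indicator (hGm n)]
        exact hGi n

/-- Apply the layer-cake formula to the truncated function with respect to the measure `g dx`.
Levels below `m` give the main term. Levels above `m` return at most `4 * ε / β ^ 2 ≤ 1 / 2` times
the left side, which truncation keeps finite, so it can be absorbed. -/
theorem HalfLarge.lintegral_min_rpow_mul_le {g : ℝ → ℝ≥0} {β : ℝ≥0} {u v : ℝ}
    (H : HalfLarge g β u v) (hg : Measurable g) (huv : u < v) (hfin : ∫⁻ y in Ioc u v, g y ≠ ∞)
    (hβ0 : 0 < β) (hβ1 : β ≤ 1) {ε : ℝ} (hε0 : 0 < ε) (hε : 8 * ε ≤ β ^ 2) (m : ℝ≥0)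
    (hm : ∫⁻ y in Ioc u v, g y ≤ m * ENNReal.ofReal (v - u)) (N : ℝ≥0) :
    ∫⁻ x in Ioc u v, (g x : ℝ≥0∞) * (min (g x) N : ℝ≥0) ^ ε ≤
      2 * (m ^ ε * ∫⁻ x in Ioc u v, (g x : ℝ≥0∞)) := by
  have hgm : Measurable fun y => (g y : ℝ≥0∞) := measurable_coe_nnreal_ennreal.comp hg
  set μ : Measure ℝ := volume.restrict (Ioc u v) with hμ
  set ν : Measure ℝ := μ.withDensity (fun y => (g y : ℝ≥0∞)) with hν
  set f : ℝ → ℝ := fun x => (min (g x) N : ℝ≥0) with hf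
  have hfm : Measurable f := measurable_coe_nnreal_real.comp (hg.min measurable_const)
  have hf0 : ∀ x, 0 ≤ f x := fun x => NNReal.coe_nonneg _
  have hνu : ν univ = ∫⁻ x, (g x : ℝ≥0∞) ∂μ := by simp [hν]
  have hβr : (0 : ℝ) < β := by exact_mod_cast hβ0
  have hβr1 : (β : ℝ) ≤ 1 := by exact_mod_cast hβ1
  have hε1 : ε ≤ 1 := by nlinarith
  have hofReal : ∀ x, ENNReal.ofReal (f x ^ ε) = ((min (g x) N : ℝ≥0) : ℝ≥0∞) ^ ε := fun x => by
    rw [hf, ← ENNReal.ofReal_rpow_of_nonneg (NNReal.coe_nonneg _) hε0.le, ENNReal.ofReal_coe_nnreal]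
  set A := ∫⁻ x, (g x : ℝ≥0∞) * (min (g x) N : ℝ≥0) ^ ε ∂μ with hA
  have hAν : A = ∫⁻ x, ENNReal.ofReal (f x ^ ε) ∂ν := by
    rw [hν, lintegral_withDensity_eq_lintegral_mul _ hgm (by fun_prop)]
    simp only [Pi.mul_apply, hofReal, hA]
  have hAfin : A ≠ ∞ := by
    refine ne_top_of_le_ne_top (b := ∫⁻ x, (g x : ℝ≥0∞) * (N : ℝ≥0∞) ^ ε ∂μ) ?_ ?_
    · rw [lintegral_mul_const _ hgm]
      exact ENNReal.mul_ne_top hfin (ENNReal.rpow_ne_top_of_nonneg hε0.le ENNReal.coe_ne_top)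
    · refine lintegral_mono fun x => ?_
      gcongr
      exact min_le_right _ _
  -- For `m ≤ t < N` truncation at `N` changes neither superlevel set, as `β * t ≤ t < N`. For `t ≥
  -- N` the left side vanishes.
  have hlevel : ∀ t : ℝ, 0 < t →
      ν {x | t < f x} * ENNReal.ofReal (t ^ (ε - 1)) ≤
        ν {_x | t < (m : ℝ)} * ENNReal.ofReal (t ^ (ε - 1)) +
          4 * (μ {x | t < f x / β} * ENNReal.ofReal (t ^ (1 + ε - 1))) := by
    intro t ht
    by_cases htm : t < m
    · refine le_add_right ?_
      exact mul_le_mul' (measure_mono fun x _ => htm) le_rfl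
    · refine le_add_left ?_
      rw [not_lt] at htm
      lift t to ℝ≥0 using ht.le
      have hml : (m : ℝ≥0∞) ≤ t := by exact_mod_cast htm
      have hlev := H.setLIntegral_superlevel_le hg huv hfin t (hm.trans (by gcongr))
      by_cases htN : t < N
      · have h1 : ν {x | (t : ℝ) < f x} ≤ 4 * t * μ {x | (t : ℝ) < f x / β} := by
          have hset : {x | (t : ℝ) < f x} = {x | t < g x} := by
            ext x
            simp only [hf, mem_ofPred_eq, NNReal.coe_lt_coe, lt_min_iff, htN, and_true]
          have hset' : {x | (t : ℝ) < f x / β} = {x | β * t < g x} := by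
            ext x
            have : β * t < N := lt_of_le_of_lt (mul_le_of_le_one_left' hβ1) htN
            simp only [mem_ofPred_eq]
            rw [lt_div_iff₀ hβr, mul_comm, hf, ← NNReal.coe_mul, NNReal.coe_lt_coe, lt_min_iff]
            simp [this]
          have hms : MeasurableSet {x | t < g x} := measurableSet_lt measurable_const hg
          have hms' : MeasurableSet {x | β * t < g x} := measurableSet_lt measurable_const hg
          rw [hset, hset', hν, withDensity_apply _ hms, hμ, Measure.restrict_restrict hms,
            Measure.restrict_apply hms', inter_comm, inter_comm {x | β * t < g x}]
          exact hlev
        have h2 : ENNReal.ofReal ((t : ℝ) ^ (1 + ε - 1)) =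
            t * ENNReal.ofReal ((t : ℝ) ^ (ε - 1)) := by
          rw [← ENNReal.ofReal_coe_nnreal, ← ENNReal.ofReal_mul (NNReal.coe_nonneg t),
            show 1 + ε - 1 = 1 + (ε - 1) by ring, Real.rpow_add ht, Real.rpow_one]
        calc _ ≤ 4 * t * μ {x | (t : ℝ) < f x / β} * ENNReal.ofReal ((t : ℝ) ^ (ε - 1)) := by
              gcongr
          _ = _ := by rw [h2]; ring
      · have : {x | (t : ℝ) < f x} = ∅ := by
          ext x
          simp only [hf, mem_ofPred_eq, NNReal.coe_lt_coe, lt_min_iff, htN, and_false,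
            mem_empty_iff_false]
        simp [this]
  -- Since `β ≤ 1` and `ε ≤ 1`, `β ^ (1 + ε) ≥ β ^ 2`; one factor of `f` is bounded by `g`.
  have hB : ∫⁻ x, ENNReal.ofReal ((f x / β) ^ (1 + ε)) ∂μ ≤ ENNReal.ofReal (((β : ℝ) ^ 2)⁻¹) * A := by
    rw [hA, ← lintegral_const_mul _ (by fun_prop)]
    refine lintegral_mono fun x => ?_
    rw [← hofReal, ← ENNReal.ofReal_coe_nnreal (p := g x), ← ENNReal.ofReal_mul (NNReal.coe_nonneg (g x)),
      ← ENNReal.ofReal_mul (by positivity)]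
    refine ENNReal.ofReal_le_ofReal ?_
    rw [Real.div_rpow (hf0 x) hβr.le, Real.rpow_add_of_nonneg (hf0 x) zero_le_one hε0.le,
      Real.rpow_one, div_eq_inv_mul]
    have h1 : f x ≤ g x := NNReal.coe_le_coe.2 (min_le_left _ _)
    have h2 : (β : ℝ) ^ 2 ≤ (β : ℝ) ^ (1 + ε) := by
      rw [← Real.rpow_natCast]
      exact Real.rpow_le_rpow_of_exponent_ge hβr hβr1 (by push_cast; linarith)
    have := hf0 x
    gcongr
  have hmain : A ≤ m ^ ε * ν univ + 2⁻¹ * A := by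
    have hconst := lintegral_rpow_eq_lintegral_meas_lt_mul ν (f := fun _ => (m : ℝ))
      (Eventually.of_forall fun _ => NNReal.coe_nonneg m) aemeasurable_const hε0
    rw [lintegral_const, ← ENNReal.ofReal_rpow_of_nonneg (NNReal.coe_nonneg m) hε0.le,
      ENNReal.ofReal_coe_nnreal] at hconst
    have hdiv := lintegral_rpow_eq_lintegral_meas_lt_mul μ (f := fun x => f x / β)
      (Eventually.of_forall fun x => div_nonneg (hf0 x) hβr.le) (by fun_prop)
      (p := 1 + ε) (by linarith)
    rw [hconst]
    nth_rewrite 1 [hAν]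
    rw [lintegral_rpow_eq_lintegral_meas_lt_mul ν (Eventually.of_forall hf0) hfm.aemeasurable hε0]
    have hmeas : Measurable fun t : ℝ => ν {_x : ℝ | t < (m : ℝ)} * ENNReal.ofReal (t ^ (ε - 1)) := by
      refine Measurable.mul (Antitone.measurable fun s t hst => measure_mono fun x hx => ?_)
        (by fun_prop)
      exact lt_of_le_of_lt hst hx
    calc _ ≤ ENNReal.ofReal ε * ∫⁻ t in Ioi (0 : ℝ),
          (ν {_x | t < (m : ℝ)} * ENNReal.ofReal (t ^ (ε - 1)) +
          4 * (μ {x | t < f x / β} * ENNReal.ofReal (t ^ (1 + ε - 1)))) := by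
          gcongr 1
          exact setLIntegral_mono' measurableSet_Ioi fun t ht => hlevel t ht
      _ = ENNReal.ofReal ε * (∫⁻ t in Ioi (0 : ℝ), ν {_x | t < (m : ℝ)} *
            ENNReal.ofReal (t ^ (ε - 1))) + ENNReal.ofReal ε *
          (4 * ∫⁻ t in Ioi (0 : ℝ), μ {x | t < f x / β} * ENNReal.ofReal (t ^ (1 + ε - 1))) := by
          rw [lintegral_add_left hmeas, lintegral_const_mul' _ _ (by simp), mul_add]
      _ ≤ _ := by
          refine add_le_add le_rfl ?_
          calc _ ≤ ENNReal.ofReal ε * (4 * (ENNReal.ofReal (1 + ε) * ∫⁻ t in Ioi (0 : ℝ),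
                μ {x | t < f x / β} * ENNReal.ofReal (t ^ (1 + ε - 1)))) := by
                gcongr
                refine le_mul_of_one_le_left' ?_
                rw [ENNReal.one_le_ofReal]; linarith
            _ ≤ ENNReal.ofReal ε * (4 * (ENNReal.ofReal (((β : ℝ) ^ 2)⁻¹) * A)) := by
                rw [← hdiv]; gcongr
            _ = ENNReal.ofReal (ε * 4 * ((β : ℝ) ^ 2)⁻¹) * A := by
                rw [ENNReal.ofReal_mul (by positivity), ENNReal.ofReal_mul hε0.le]
                simp only [ENNReal.ofReal_ofNat]; ring
            _ ≤ ENNReal.ofReal (2⁻¹) * A := by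
                gcongr
                rw [← div_eq_mul_inv, div_le_iff₀ (by positivity)]
                linarith
            _ = _ := by
                rw [ENNReal.ofReal_inv_of_pos (by norm_num), ENNReal.ofReal_ofNat]
  rw [← hνu]
  have hhalf : A = 2⁻¹ * A + 2⁻¹ * A := by rw [← add_mul, ENNReal.inv_two_add_inv_two, one_mul]
  have h2fin : 2⁻¹ * A ≠ ∞ := ENNReal.mul_ne_top (by simp) hAfin
  have : 2⁻¹ * A ≤ m ^ ε * ν univ := by
    refine (ENNReal.add_le_add_iff_right h2fin).1 ?_
    rw [← hhalf]; exact hmain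
  calc A = 2 * (2⁻¹ * A) := by
        rw [← mul_assoc, ENNReal.mul_inv_cancel (by simp) (by simp), one_mul]
    _ ≤ _ := by gcongr

/-- The reverse Hölder inequality on an interval. -/
theorem HalfLarge.reverse_holder {g : ℝ → ℝ≥0} {β : ℝ≥0} {u v : ℝ}
    (H : HalfLarge g β u v) (hg : Measurable g) (huv : u < v) (hfin : ∫⁻ y in Ioc u v, g y ≠ ∞)
    (hβ0 : 0 < β) (hβ1 : β ≤ 1) {ε : ℝ} (hε0 : 0 < ε) (hε : 8 * ε ≤ β ^ 2) :
    (∫⁻ x in Ioc u v, (g x : ℝ≥0∞) ^ (1 + ε)) / ENNReal.ofReal (v - u) ≤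
      2 * ((∫⁻ x in Ioc u v, (g x : ℝ≥0∞)) / ENNReal.ofReal (v - u)) ^ (1 + ε) := by
  have hpos : ENNReal.ofReal (v - u) ≠ 0 := by simpa using huv
  set M := (∫⁻ x in Ioc u v, (g x : ℝ≥0∞)) / ENNReal.ofReal (v - u) with hM
  have hMfin : M ≠ ∞ := ENNReal.div_ne_top hfin hpos
  have hMeq : ∫⁻ x in Ioc u v, (g x : ℝ≥0∞) = M * ENNReal.ofReal (v - u) :=
    (ENNReal.div_mul_cancel hpos ENNReal.ofReal_ne_top).symm
  have hgm : Measurable fun y => (g y : ℝ≥0∞) := measurable_coe_nnreal_ennreal.comp hg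
  have hN := fun N : ℕ => H.lintegral_min_rpow_mul_le hg huv hfin hβ0 hβ1 hε0 hε M.toNNReal
    (by rw [ENNReal.coe_toNNReal hMfin, hMeq]) N
  simp only [ENNReal.coe_toNNReal hMfin] at hN
  refine ENNReal.div_le_of_le_mul ?_
  -- The truncated bound is uniform in `N`, so Fatou's lemma removes the truncation.
  calc ∫⁻ x in Ioc u v, (g x : ℝ≥0∞) ^ (1 + ε)
      ≤ ∫⁻ x in Ioc u v, liminf (fun N : ℕ => (g x : ℝ≥0∞) * (min (g x) N : ℝ≥0) ^ ε) atTop := by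
        refine lintegral_mono fun x => ?_
        refine le_liminf_of_le (by isBoundedDefault) ?_
        obtain ⟨n, hn⟩ := exists_nat_ge (g x)
        filter_upwards [eventually_ge_atTop n] with k hk
        have : min (g x) (k : ℝ≥0) = g x := min_eq_left (hn.trans (by exact_mod_cast hk))
        rw [this, ENNReal.rpow_add_of_nonneg _ _ zero_le_one hε0.le, ENNReal.rpow_one]
    _ ≤ liminf (fun N : ℕ => ∫⁻ x in Ioc u v, (g x : ℝ≥0∞) * (min (g x) N : ℝ≥0) ^ ε) atTop :=
        lintegral_liminf_le fun N => by fun_prop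
    _ ≤ 2 * (M ^ ε * ∫⁻ x in Ioc u v, (g x : ℝ≥0∞)) :=
        liminf_le_of_le (by isBoundedDefault) fun b hb =>
          let ⟨n, hn⟩ := hb.exists; hn.trans (hN n)
    _ = _ := by
        rw [hMeq, ENNReal.rpow_add_of_nonneg _ _ zero_le_one hε0.le, ENNReal.rpow_one]
        ring

/-- The `A_p` condition on subintervals of `(u, v]` yields `HalfLarge`. -/
theorem halfLarge_of_muckenhoupt {g : ℝ → ℝ≥0} (hg : Measurable g) {u v κ : ℝ} (hκ : 0 < κ)
    {C β : ℝ≥0} (hβ0 : 0 < β) (hβ : 2 * (C * β) ^ κ ≤ 1)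
    (hpos : ∀ a b, u ≤ a → a < b → b ≤ v → ∫⁻ y in Ioc a b, g y ≠ 0)
    (hfin : ∫⁻ y in Ioc u v, g y ≠ ∞)
    (h : ∀ a b, u ≤ a → a < b → b ≤ v →
      (∫⁻ y in Ioc a b, (g y : ℝ≥0∞) ^ (-κ)) / ENNReal.ofReal (b - a) *
        ((∫⁻ y in Ioc a b, g y) / ENNReal.ofReal (b - a)) ^ κ ≤ C ^ κ) :
    HalfLarge g β u v := by
  intro a b hua hab hbv
  set D := ENNReal.ofReal (b - a) with hD
  have hD0 : D ≠ 0 := by simpa [hD] using hab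
  have hDt : D ≠ ∞ := ENNReal.ofReal_ne_top
  set S := ∫⁻ y in Ioc a b, (g y : ℝ≥0∞) with hS
  set Q := ∫⁻ y in Ioc a b, (g y : ℝ≥0∞) ^ (-κ) with hQ
  have hSt : S ≠ ∞ := ne_top_of_le_ne_top hfin (lintegral_mono_set (Ioc_subset_Ioc hua hbv))
  set M := S / D with hM
  have hβM0 : (β : ℝ≥0∞) * M ≠ 0 := mul_ne_zero (by simpa using hβ0.ne')
    (ENNReal.div_ne_zero.2 ⟨hpos a b hua hab hbv, hDt⟩)
  have hβMt : (β : ℝ≥0∞) * M ≠ ∞ := ENNReal.mul_ne_top ENNReal.coe_ne_top (ENNReal.div_ne_top hSt hD0)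
  have hgm : Measurable fun y => (g y : ℝ≥0∞) := measurable_coe_nnreal_ennreal.comp hg
  set P := {x | (β : ℝ≥0∞) * S < g x * D} with hP
  have hPm : MeasurableSet P := measurableSet_lt measurable_const (hgm.mul_const _)
  have hsum : volume (Ioc a b ∩ P) + volume (Ioc a b \ P) = D := by
    rw [measure_inter_add_sdiff _ hPm, Real.volume_Ioc]
  -- Chebyshev: where `g ≤ β * M`, the function `g ^ (-κ)` is at least `(β * M) ^ (-κ)`. The
  -- hypothesis then makes this set at most a `(C * β) ^ κ ≤ 1 / 2` part of the interval.
  have hE : ((β : ℝ≥0∞) * M) ^ (-κ) * volume (Ioc a b \ P) ≤ Q := by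
    rw [hQ, ← setLIntegral_const]
    refine (setLIntegral_mono' (measurableSet_Ioc.diff hPm) fun x hx => ?_).trans
      (lintegral_mono_set sdiff_subset)
    have hx2 : (g x : ℝ≥0∞) * D ≤ β * S := not_lt.1 hx.2
    have hgx : (g x : ℝ≥0∞) ≤ β * M := by
      rw [hM, ← mul_div_assoc]
      exact ENNReal.le_div_iff_mul_le (Or.inl hD0) (Or.inl hDt) |>.2 hx2
    rw [ENNReal.rpow_neg, ENNReal.rpow_neg]
    gcongr
  have hEle : volume (Ioc a b \ P) ≤ (C * β : ℝ≥0) ^ κ * D := by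
    calc volume (Ioc a b \ P)
        = ((β : ℝ≥0∞) * M) ^ κ * (((β : ℝ≥0∞) * M) ^ (-κ) * volume (Ioc a b \ P)) := by
          rw [← mul_assoc, ← ENNReal.rpow_add _ _ hβM0 hβMt, add_neg_cancel, ENNReal.rpow_zero,
            one_mul]
      _ ≤ ((β : ℝ≥0∞) * M) ^ κ * Q := by gcongr
      _ = (β : ℝ≥0∞) ^ κ * (Q / D * M ^ κ) * D := by
          rw [ENNReal.mul_rpow_of_nonneg _ _ hκ.le]
          nth_rewrite 1 [← ENNReal.div_mul_cancel hD0 hDt (b := Q)]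
          ring
      _ ≤ (β : ℝ≥0∞) ^ κ * C ^ κ * D := by
          gcongr
          exact h a b hua hab hbv
      _ = _ := by rw [ENNReal.coe_mul, ENNReal.mul_rpow_of_nonneg _ _ hκ.le, mul_comm (_ ^ κ)]
  have h2E : 2 * volume (Ioc a b \ P) ≤ D := by
    calc 2 * volume (Ioc a b \ P) ≤ 2 * ((C * β : ℝ≥0) ^ κ * D) := by gcongr
      _ = (2 * (C * β) ^ κ : ℝ≥0) * D := by
          have : ((2 * (C * β) ^ κ : ℝ≥0) : ℝ≥0∞) = 2 * ((C * β : ℝ≥0) : ℝ≥0∞) ^ κ := by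
            rw [ENNReal.coe_mul, ENNReal.coe_rpow_of_nonneg _ hκ.le]; rfl
          rw [this, mul_assoc]
      _ ≤ 1 * D := by gcongr; exact_mod_cast hβ
      _ = D := one_mul D
  refine (ENNReal.add_le_add_iff_right hDt).1 ?_
  calc D + D = 2 * volume (Ioc a b ∩ P) + 2 * volume (Ioc a b \ P) := by
        rw [← mul_add, hsum, two_mul]
    _ ≤ _ := by gcongr

/-! ### Power means indexed by reciprocal exponents -/

section PowMean

variable {α : Type*} [MeasurableSpace α]

/-- The power mean `(∫ f ^ (1 / x)) ^ x`, that is, the `L^{1/x}` norm. -/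
noncomputable def powMean (μ : Measure α) (x : ℝ) (f : α → ℝ≥0∞) : ℝ≥0∞ :=
  (∫⁻ a, f a ^ (1 / x) ∂μ) ^ x

theorem powMean_congr {μ : Measure α} {x : ℝ} {f g : α → ℝ≥0∞} (h : f =ᵐ[μ] g) :
    powMean μ x f = powMean μ x g := by
  unfold powMean
  rw [lintegral_congr_ae]
  filter_upwards [h] with a ha
  rw [ha]

theorem powMean_mono {μ : Measure α} {x : ℝ} (hx : 0 < x) {f g : α → ℝ≥0∞}
    (h : ∀ᵐ a ∂μ, f a ≤ g a) : powMean μ x f ≤ powMean μ x g := by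
  unfold powMean
  gcongr ?_ ^ x
  refine lintegral_mono_ae ?_
  filter_upwards [h] with a ha
  gcongr

theorem powMean_const {μ : Measure α} [IsProbabilityMeasure μ] {x : ℝ} (hx : 0 < x) (c : ℝ≥0∞) :
    powMean μ x (fun _ => c) = c := by
  simp [powMean, ← ENNReal.rpow_mul, hx.ne']

theorem powMean_const_mul {μ : Measure α} {x : ℝ} (hx : 0 < x) {f : α → ℝ≥0∞}
    (hf : AEMeasurable f μ) (c : ℝ≥0∞) :
    powMean μ x (fun a => c * f a) = c * powMean μ x f := by
  unfold powMean
  simp_rw [ENNReal.mul_rpow_of_nonneg _ _ (one_div_pos.2 hx).le]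
  rw [lintegral_const_mul'' _ (hf.pow_const _), ENNReal.mul_rpow_of_nonneg _ _ hx.le,
    ← ENNReal.rpow_mul, one_div_mul_cancel hx.ne', ENNReal.rpow_one]

/-- Hölder's inequality; the reciprocal indexing is chosen so that indices simply add. -/
theorem powMean_mul_le {μ : Measure α} {x y : ℝ} (hx : 0 < x) (hy : 0 < y) {f g : α → ℝ≥0∞}
    (hf : AEMeasurable f μ) (hg : AEMeasurable g μ) :
    powMean μ (x + y) (fun a => f a * g a) ≤ powMean μ x f * powMean μ y g := by
  have hxy : 0 < x + y := by linarith
  have h := ENNReal.lintegral_mul_norm_pow_le (μ := μ) (hf.pow_const (1 / x))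
    (hg.pow_const (1 / y)) (p := x / (x + y)) (q := y / (x + y)) (by positivity) (by positivity)
    (by field_simp)
  simp_rw [← ENNReal.rpow_mul] at h
  rw [show 1 / x * (x / (x + y)) = 1 / (x + y) by field_simp,
    show 1 / y * (y / (x + y)) = 1 / (x + y) by field_simp] at h
  have h2 := ENNReal.rpow_le_rpow h hxy.le
  rw [ENNReal.mul_rpow_of_nonneg _ _ hxy.le, ← ENNReal.rpow_mul, ← ENNReal.rpow_mul,
    div_mul_cancel₀ _ hxy.ne', div_mul_cancel₀ _ hxy.ne'] at h2
  unfold powMean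
  simp_rw [ENNReal.mul_rpow_of_nonneg _ _ (one_div_pos.2 hxy).le]
  exact h2

theorem powMean_anti {μ : Measure α} [IsProbabilityMeasure μ] {x y : ℝ} (hx : 0 < x) (hxy : x ≤ y)
    {f : α → ℝ≥0∞} (hf : AEMeasurable f μ) : powMean μ y f ≤ powMean μ x f := by
  rcases hxy.eq_or_lt with rfl | hxy
  · rfl
  · have := powMean_mul_le (μ := μ) hx (sub_pos.2 hxy) hf (g := fun _ => 1) aemeasurable_const
    simpa [powMean_const (μ := μ) (sub_pos.2 hxy)] using this

theorem powMean_rpow {μ : Measure α} {x c : ℝ} (hc : 0 < c) (f : α → ℝ≥0∞) :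
    powMean μ (c * x) (fun a => f a ^ c) = powMean μ x f ^ c := by
  unfold powMean
  simp_rw [← ENNReal.rpow_mul]
  rw [show c * (1 / (c * x)) = 1 / x by field_simp, mul_comm c x]

theorem powMean_one (μ : Measure α) (f : α → ℝ≥0∞) : powMean μ 1 f = ∫⁻ a, f a ∂μ := by
  simp [powMean]

theorem powMean_ne_zero {μ : Measure α} [NeZero μ] {x : ℝ} (hx : 0 < x) {f : α → ℝ≥0∞}
    (hf : AEMeasurable f μ) (h : ∀ᵐ a ∂μ, 0 < f a) : powMean μ x f ≠ 0 := by
  unfold powMean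
  rw [Ne, ENNReal.rpow_eq_zero_iff_of_pos hx, lintegral_eq_zero_iff' (hf.pow_const _)]
  intro h0
  have : ∀ᵐ a ∂μ, False := by
    filter_upwards [h, h0] with a ha ha0
    simp only [Pi.zero_apply] at ha0
    rw [ENNReal.rpow_eq_zero_iff_of_pos (one_div_pos.2 hx)] at ha0
    exact ha.ne' ha0
  rw [eventually_false_iff_eq_bot, ae_eq_bot] at this
  exact NeZero.ne μ this

end PowMean

/-! ### Lifting arcs to intervals of the line -/

section Arcs

theorem measurableSet_arc {s s' : ℝ} (h : s' ≤ s + 1) : MeasurableSet (arc s s') := by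
  have : arc s s' = (AddCircle.measurableEquivIoc 1 s) ⁻¹' {y | (y : ℝ) ≤ s'} := by
    ext x
    constructor
    · rintro ⟨y, hy, rfl⟩
      have hy' : y ∈ Ioc s (s + 1) := ⟨hy.1, hy.2.trans h⟩
      change ((AddCircle.equivIoc (1 : ℝ) s (y : UnitAddCircle) : ℝ)) ≤ s'
      rw [AddCircle.equivIoc_coe_of_mem hy']
      exact hy.2
    · intro hx
      refine ⟨(AddCircle.equivIoc (1 : ℝ) s x : ℝ), ⟨(AddCircle.equivIoc (1 : ℝ) s x).2.1, hx⟩, ?_⟩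
      exact (AddCircle.equivIoc (1 : ℝ) s).symm_apply_apply x
  rw [this]
  exact (AddCircle.measurableEquivIoc 1 s).measurable
    (measurableSet_le measurable_subtype_coe measurable_const)

theorem measurePreserving_mk_arc {s s' : ℝ} (h : s' ≤ s + 1) :
    MeasurePreserving (fun x : ℝ => (x : UnitAddCircle)) (volume.restrict (Ioc s s'))
      (volume.restrict (arc s s')) := by
  have h1 := (AddCircle.measurePreserving_mk (1 : ℝ) s).restrict_preimage (measurableSet_arc h)
  rw [Measure.restrict_restrict (AddCircle.measurable_mk' (measurableSet_arc h))] at h1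
  have hset : QuotientAddGroup.mk ⁻¹' arc s s' ∩ Ioc s (s + 1) = Ioc s s' := by
    ext x
    constructor
    · rintro ⟨⟨y, hy, hyx⟩, hx⟩
      have hy' : y ∈ Ioc s (s + 1) := ⟨hy.1, hy.2.trans h⟩
      have := (AddCircle.coe_eq_coe_iff_of_mem_Ioc (p := (1 : ℝ)) (a := s) hy' hx).1 hyx
      rwa [← this]
    · intro hx
      exact ⟨⟨x, hx, rfl⟩, hx.1, hx.2.trans h⟩
  rwa [hset] at h1

theorem volume_arc {s s' : ℝ} (h : s' ≤ s + 1) : volume (arc s s') = ENNReal.ofReal (s' - s) := by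
  have := (measurePreserving_mk_arc h).measure_preimage (s := univ) MeasurableSet.univ.nullMeasurableSet
  simpa using this.symm

/-- The normalized Lebesgue measure on `I`. -/
noncomputable def avgMeasure (I : Set UnitAddCircle) : Measure UnitAddCircle :=
  (volume.restrict I univ)⁻¹ • volume.restrict I

theorem IsArc.isProbabilityMeasure {I : Set UnitAddCircle} (hI : IsArc I) :
    IsProbabilityMeasure (avgMeasure I) := by
  obtain ⟨s, s', h1, h2, rfl⟩ := hI
  have : NeZero (volume.restrict (arc s s')) := ⟨by
    rw [Ne, Measure.restrict_eq_zero, volume_arc h2]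
    simpa using h1⟩
  unfold avgMeasure
  infer_instance

theorem avgMeasure_absolutelyContinuous (I : Set UnitAddCircle) : avgMeasure I ≪ volume :=
  (Measure.smul_absolutelyContinuous).trans Measure.absolutelyContinuous_restrict

theorem avg_eq_lintegral (I : Set UnitAddCircle) (f : UnitAddCircle → ℝ) :
    avg I f = ∫⁻ x, ENNReal.ofReal (f x) ∂avgMeasure I := rfl

theorem lintegral_avgMeasure_arc {s s' : ℝ} (h : s' ≤ s + 1) {F : UnitAddCircle → ℝ≥0∞}
    (hF : Measurable F) : ∫⁻ x, F x ∂avgMeasure (arc s s') =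
      (∫⁻ x in Ioc s s', F (x : UnitAddCircle)) / ENNReal.ofReal (s' - s) := by
  rw [avgMeasure, lintegral_smul_measure, Measure.restrict_apply_univ, volume_arc h,
    ← (measurePreserving_mk_arc h).lintegral_comp hF, smul_eq_mul, ENNReal.div_eq_inv_mul]

theorem isArc_univ : IsArc univ := by
  refine ⟨0, 0 + 1, by norm_num, by norm_num, ?_⟩
  refine (eq_univ_of_forall fun x => ?_).symm
  exact ⟨_, (AddCircle.equivIoc (1 : ℝ) 0 x).2, (AddCircle.equivIoc (1 : ℝ) 0).symm_apply_apply x⟩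

theorem avgMeasure_univ : avgMeasure univ = volume := by
  simp [avgMeasure]

end Arcs

/-! ### Reverse Hölder inequality on the circle -/

/-- A reverse Hölder inequality for functions that satisfy a Muckenhoupt condition on arcs. -/
theorem exists_reverse_holder {φ : UnitAddCircle → ℝ≥0∞} (hφ : AEMeasurable φ)
    (hpos : ∀ᵐ x, 0 < φ x) (hlt : ∀ᵐ x, φ x < ∞) {κ : ℝ} (hκ : 0 < κ) (C : ℝ≥0)
    (h : ∀ I, IsArc I →
      (∫⁻ x, φ x ^ (-κ) ∂avgMeasure I) * (∫⁻ x, φ x ∂avgMeasure I) ^ κ ≤ C ^ κ) :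
    ∃ ε : ℝ, 0 < ε ∧ ∀ I, IsArc I →
      ∫⁻ x, φ x ^ (1 + ε) ∂avgMeasure I ≤ 2 * (∫⁻ x, φ x ∂avgMeasure I) ^ (1 + ε) := by
  set G : UnitAddCircle → ℝ≥0 := fun x => (hφ.mk φ x).toNNReal with hG
  have hGm : Measurable G := hφ.measurable_mk.ennreal_toNNReal
  have hGe : Measurable fun x => (G x : ℝ≥0∞) := measurable_coe_nnreal_ennreal.comp hGm
  have hφG : φ =ᵐ[volume] fun x => (G x : ℝ≥0∞) := by
    filter_upwards [hφ.ae_eq_mk, hlt] with x hx hx'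
    rw [hG, ENNReal.coe_toNNReal (hx ▸ hx'.ne), hx]
  have hcongr : ∀ (c : ℝ) (I : Set UnitAddCircle),
      ∫⁻ x, φ x ^ c ∂avgMeasure I = ∫⁻ x, (G x : ℝ≥0∞) ^ c ∂avgMeasure I := fun c I =>
    lintegral_congr_ae <| ((avgMeasure_absolutelyContinuous I).ae_eq hφG).mono fun x hx => by
      simp only [hx]
  have hcongr1 : ∀ I : Set UnitAddCircle,
      ∫⁻ x, φ x ∂avgMeasure I = ∫⁻ x, (G x : ℝ≥0∞) ∂avgMeasure I := fun I =>
    lintegral_congr_ae ((avgMeasure_absolutelyContinuous I).ae_eq hφG)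
  have hne0 : ∀ I, IsArc I → ∫⁻ x, φ x ∂avgMeasure I ≠ 0 := fun I hI => by
    have := hI.isProbabilityMeasure
    rw [← powMean_one]
    exact powMean_ne_zero one_pos (hφ.mono_ac (avgMeasure_absolutelyContinuous I))
      ((avgMeasure_absolutelyContinuous I).ae_le hpos)
  -- An infinite average would violate the bound, since the average of `φ ^ (-κ)` is positive.
  have hnet : ∀ I, IsArc I → ∫⁻ x, φ x ∂avgMeasure I ≠ ∞ := fun I hI htop => by
    have hp := hI.isProbabilityMeasure
    have hac := avgMeasure_absolutelyContinuous I
    have h0 : ∫⁻ x, φ x ^ (-κ) ∂avgMeasure I ≠ 0 := by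
      rw [← powMean_one]
      refine powMean_ne_zero one_pos ((hφ.mono_ac hac).pow_const _) ?_
      filter_upwards [hac.ae_le hlt] with x hx
      rw [ENNReal.rpow_neg, ENNReal.inv_pos]
      exact ENNReal.rpow_ne_top_of_nonneg hκ.le hx.ne
    have hI' := h I hI
    rw [htop, ENNReal.top_rpow_of_pos hκ, ENNReal.mul_top h0] at hI'
    exact ENNReal.rpow_ne_top_of_nonneg hκ.le ENNReal.coe_ne_top (top_le_iff.1 hI')
  obtain ⟨β, hβ0, hβ1, hβ⟩ : ∃ β : ℝ≥0, 0 < β ∧ β ≤ 1 ∧ 2 * (C * β) ^ κ ≤ 1 := by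
    have hlim : Tendsto (fun β : ℝ≥0 => 2 * (C * β) ^ κ) (𝓝[>] 0) (𝓝 (2 * (C * 0) ^ κ)) := by
      refine Tendsto.mono_left ?_ nhdsWithin_le_nhds
      exact ((NNReal.continuous_rpow_const hκ.le).comp (continuous_const_mul C)).const_mul 2
        |>.tendsto 0
    rw [mul_zero, NNReal.zero_rpow hκ.ne', mul_zero] at hlim
    obtain ⟨β, h1, h2, h3⟩ := ((hlim.eventually (ge_mem_nhds one_pos)).and
      ((Ioc_mem_nhdsGT one_pos))).exists
    exact ⟨β, h2, h3, h1⟩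
  -- `β` depends only on `C` and `κ`, so this exponent gain is the same for all arcs.
  refine ⟨β ^ 2 / 8, by positivity, ?_⟩
  rintro _ ⟨u, v, huv, hv, rfl⟩
  set g : ℝ → ℝ≥0 := fun x => G (x : UnitAddCircle) with hg
  have hgm : Measurable g := hGm.comp AddCircle.measurable_mk'
  have hsub : ∀ a b, u ≤ a → a < b → b ≤ v → IsArc (arc a b) := fun a b h1 h2 h3 =>
    ⟨a, b, h2, by linarith, rfl⟩
  have hint : ∀ a b, u ≤ a → a < b → b ≤ v → ∫⁻ x, φ x ∂avgMeasure (arc a b) =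
      (∫⁻ y in Ioc a b, (g y : ℝ≥0∞)) / ENNReal.ofReal (b - a) := fun a b h1 h2 h3 => by
    rw [hcongr1, lintegral_avgMeasure_arc (by linarith) hGe]
  have hintp : ∀ (c : ℝ) (a b : ℝ), u ≤ a → a < b → b ≤ v →
      ∫⁻ x, φ x ^ c ∂avgMeasure (arc a b) =
      (∫⁻ y in Ioc a b, (g y : ℝ≥0∞) ^ c) / ENNReal.ofReal (b - a) := fun c a b h1 h2 h3 => by
    rw [hcongr, lintegral_avgMeasure_arc (by linarith) (hGe.pow_const c)]
  have hfin : ∫⁻ y in Ioc u v, (g y : ℝ≥0∞) ≠ ∞ := fun htop => by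
    have := hnet _ (hsub u v le_rfl huv le_rfl)
    rw [hint u v le_rfl huv le_rfl, htop] at this
    exact this (ENNReal.top_div_of_ne_top ENNReal.ofReal_ne_top)
  have hH : HalfLarge g β u v := by
    refine halfLarge_of_muckenhoupt hgm hκ hβ0 hβ (fun a b h1 h2 h3 h0 => ?_) hfin
      fun a b h1 h2 h3 => ?_
    · have := hne0 _ (hsub a b h1 h2 h3)
      rw [hint a b h1 h2 h3, h0] at this
      simp at this
    · rw [← hint a b h1 h2 h3, ← hintp _ a b h1 h2 h3]
      exact h _ (hsub a b h1 h2 h3)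
  rw [hint u v le_rfl huv le_rfl, hintp _ u v le_rfl huv le_rfl]
  exact hH.reverse_holder hgm huv hfin hβ0 hβ1 (by positivity) (by linarith)

/-! ### Two-sided conditions and their self-improvement -/

/-- Functions on the circle that are almost everywhere measurable with values in `(0, ∞)`. -/
structure IsPosFinite (f : UnitAddCircle → ℝ≥0∞) : Prop where
  aemeasurable : AEMeasurable f
  pos : ∀ᵐ x, 0 < f x
  lt_top : ∀ᵐ x, f x < ∞

theorem IsPosFinite.inv {f : UnitAddCircle → ℝ≥0∞} (hf : IsPosFinite f) :
    IsPosFinite fun x => (f x)⁻¹ :=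
  ⟨hf.aemeasurable.inv, hf.lt_top.mono fun _ hx => ENNReal.inv_pos.2 hx.ne,
    hf.pos.mono fun _ hx => ENNReal.inv_lt_top.2 hx⟩

theorem IsPosFinite.rpow {f : UnitAddCircle → ℝ≥0∞} (hf : IsPosFinite f) {c : ℝ} (hc : 0 < c) :
    IsPosFinite fun x => f x ^ c :=
  ⟨hf.aemeasurable.pow_const c, hf.pos.mono fun _ hx => ENNReal.rpow_pos_of_nonneg hx hc.le,
    hf.lt_top.mono fun _ hx => ENNReal.rpow_lt_top_of_nonneg hc.le hx.ne⟩

theorem IsPosFinite.mul {f g : UnitAddCircle → ℝ≥0∞} (hf : IsPosFinite f) (hg : IsPosFinite g) :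
    IsPosFinite fun x => f x * g x :=
  ⟨hf.aemeasurable.mul hg.aemeasurable, by
    filter_upwards [hf.pos, hg.pos] with x h1 h2 using ENNReal.mul_pos h1.ne' h2.ne', by
    filter_upwards [hf.lt_top, hg.lt_top] with x h1 h2 using ENNReal.mul_lt_top h1 h2⟩

theorem IsWeight.isPosFinite {w : UnitAddCircle → ℝ} (hw : IsWeight w) :
    IsPosFinite fun x => ENNReal.ofReal (w x) :=
  ⟨hw.1.aestronglyMeasurable.aemeasurable.ennreal_ofReal,
    hw.2.mono fun _ hx => ENNReal.ofReal_pos.2 hx, ae_of_all _ fun _ => ENNReal.ofReal_lt_top⟩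

/-- The two-sided Muckenhoupt condition
`sup_I (avg_I f ^ (-1 / x)) ^ x * (avg_I f ^ (1 / y)) ^ y < ∞`. -/
def TwoSided (f : UnitAddCircle → ℝ≥0∞) (x y : ℝ) : Prop :=
  ∃ C : ℝ≥0, ∀ I, IsArc I →
    powMean (avgMeasure I) x (fun a => (f a)⁻¹) * powMean (avgMeasure I) y f ≤ C

theorem powMean_avgMeasure_congr {f g : UnitAddCircle → ℝ≥0∞} (h : f =ᵐ[volume] g)
    (I : Set UnitAddCircle) (x : ℝ) : powMean (avgMeasure I) x f = powMean (avgMeasure I) x g :=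
  powMean_congr ((avgMeasure_absolutelyContinuous I).ae_eq h)

theorem TwoSided.congr {f g : UnitAddCircle → ℝ≥0∞} {x y : ℝ} (h : TwoSided f x y)
    (hfg : f =ᵐ[volume] g) : TwoSided g x y := by
  obtain ⟨C, hC⟩ := h
  refine ⟨C, fun I hI => ?_⟩
  rw [← powMean_avgMeasure_congr hfg,
    ← powMean_avgMeasure_congr (f := fun a => (f a)⁻¹) (hfg.mono fun a ha => by simp only [ha])]
  exact hC I hI

theorem TwoSided.inv {f : UnitAddCircle → ℝ≥0∞} {x y : ℝ} (h : TwoSided f x y) :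
    TwoSided (fun a => (f a)⁻¹) y x := by
  obtain ⟨C, hC⟩ := h
  refine ⟨C, fun I hI => ?_⟩
  simp only [inv_inv]
  rw [mul_comm]
  exact hC I hI

theorem TwoSided.rpow {f : UnitAddCircle → ℝ≥0∞} {x y c : ℝ} (h : TwoSided f x y) (hc : 0 < c) :
    TwoSided (fun a => f a ^ c) (c * x) (c * y) := by
  obtain ⟨C, hC⟩ := h
  refine ⟨C ^ c, fun I hI => ?_⟩
  simp_rw [← ENNReal.inv_rpow]
  rw [powMean_rpow hc, powMean_rpow hc, ← ENNReal.mul_rpow_of_nonneg _ _ hc.le,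
    ENNReal.coe_rpow_of_nonneg _ hc.le]
  exact ENNReal.rpow_le_rpow (hC I hI) hc.le

/-- Hölder's inequality is applied separately to the means of the inverses and to the means of the
functions. -/
theorem TwoSided.mul {f g : UnitAddCircle → ℝ≥0∞} {x y x' y' : ℝ} (hf : IsPosFinite f)
    (hg : IsPosFinite g) (h : TwoSided f x y) (h' : TwoSided g x' y') (hx : 0 < x) (hy : 0 < y)
    (hx' : 0 < x') (hy' : 0 < y') : TwoSided (fun a => f a * g a) (x + x') (y + y') := by
  obtain ⟨C, hC⟩ := h
  obtain ⟨D, hD⟩ := h'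
  refine ⟨C * D, fun I hI => ?_⟩
  have hac := avgMeasure_absolutelyContinuous I
  have hinv : (fun a => (f a * g a)⁻¹) =ᵐ[volume] fun a => (f a)⁻¹ * (g a)⁻¹ := by
    filter_upwards [hf.pos, hf.lt_top] with a h1 h2
    exact ENNReal.mul_inv (Or.inl h1.ne') (Or.inl h2.ne)
  rw [powMean_avgMeasure_congr hinv]
  calc _ ≤ (powMean (avgMeasure I) x (fun a => (f a)⁻¹) *
        powMean (avgMeasure I) x' (fun a => (g a)⁻¹)) *
        (powMean (avgMeasure I) y f * powMean (avgMeasure I) y' g) :=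
        mul_le_mul' (powMean_mul_le hx hx' (hf.inv.aemeasurable.mono_ac hac)
          (hg.inv.aemeasurable.mono_ac hac)) (powMean_mul_le hy hy'
          (hf.aemeasurable.mono_ac hac) (hg.aemeasurable.mono_ac hac))
    _ = (powMean (avgMeasure I) x (fun a => (f a)⁻¹) * powMean (avgMeasure I) y f) *
        (powMean (avgMeasure I) x' (fun a => (g a)⁻¹) * powMean (avgMeasure I) y' g) := by ring
    _ ≤ C * D := mul_le_mul' (hC I hI) (hD I hI)
    _ = _ := (ENNReal.coe_mul _ _).symm

theorem TwoSided.mono_right {f : UnitAddCircle → ℝ≥0∞} {x y y' : ℝ} (hf : IsPosFinite f)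
    (h : TwoSided f x y) (hy : 0 < y) (hyy' : y ≤ y') : TwoSided f x y' := by
  obtain ⟨C, hC⟩ := h
  refine ⟨C, fun I hI => (mul_le_mul' le_rfl ?_).trans (hC I hI)⟩
  have := hI.isProbabilityMeasure
  exact powMean_anti hy hyy' (hf.aemeasurable.mono_ac (avgMeasure_absolutelyContinuous I))

theorem TwoSided.powMean_ne_top {f : UnitAddCircle → ℝ≥0∞} {x y : ℝ} (hf : IsPosFinite f)
    (h : TwoSided f x y) (hx : 0 < x) {I : Set UnitAddCircle} (hI : IsArc I) :
    powMean (avgMeasure I) y f ≠ ∞ := by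
  obtain ⟨C, hC⟩ := h
  have := hI.isProbabilityMeasure
  have hac := avgMeasure_absolutelyContinuous I
  intro htop
  have h0 : powMean (avgMeasure I) x (fun a => (f a)⁻¹) ≠ 0 :=
    powMean_ne_zero hx (hf.inv.aemeasurable.mono_ac hac) (hac.ae_le hf.inv.pos)
  have := hC I hI
  rw [htop, ENNReal.mul_top h0] at this
  exact ENNReal.coe_ne_top (top_le_iff.1 this)

/-- Self-improvement of the integrability exponent. -/
theorem TwoSided.exists_lt {f : UnitAddCircle → ℝ≥0∞} {x y : ℝ} (hf : IsPosFinite f)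
    (h : TwoSided f x y) (hx : 0 < x) (hy : 0 < y) :
    ∃ y', 0 < y' ∧ y' < y ∧ ∀ x', TwoSided f x' y → TwoSided f x' y' := by
  obtain ⟨C, hC⟩ := h
  -- With `φ = f ^ (1 / y)` and `κ = y / x`, `φ ^ (-κ)` is `f ^ (-1 / x)`, and the Muckenhoupt bound
  -- for `φ` is the given condition raised to the power `1 / x`.
  have hφ := hf.rpow (one_div_pos.2 hy)
  have hκ : 0 < y / x := div_pos hy hx
  obtain ⟨ε, hε, hrh⟩ := exists_reverse_holder hφ.aemeasurable hφ.pos hφ.lt_top hκ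
    ((C ^ (1 / x)) ^ (x / y)) fun I hI => by
      have h1 := ENNReal.rpow_le_rpow (hC I hI) (one_div_pos.2 hx).le
      rw [ENNReal.mul_rpow_of_nonneg _ _ (one_div_pos.2 hx).le, powMean, powMean,
        ← ENNReal.rpow_mul, ← ENNReal.rpow_mul, mul_one_div_cancel hx.ne', ENNReal.rpow_one,
        mul_one_div] at h1
      have h2 : ∀ a, (f a ^ (1 / y)) ^ (-(y / x)) = (f a)⁻¹ ^ (1 / x) := fun a => by
        rw [← ENNReal.rpow_mul, ENNReal.inv_rpow, ← ENNReal.rpow_neg]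
        congr 1
        field_simp
      simp_rw [h2]
      refine h1.trans (le_of_eq ?_)
      rw [← ENNReal.coe_rpow_of_nonneg _ hκ.le, ← NNReal.rpow_mul, ← ENNReal.coe_rpow_of_nonneg _
        (one_div_pos.2 hx).le, show x / y * (y / x) = 1 by field_simp, NNReal.rpow_one]
  -- The comparison of the means of index `y / (1 + ε)` and `y` does not involve the first index.
  -- Hence one `y'` serves every `x'`.
  refine ⟨y / (1 + ε), by positivity, div_lt_self hy (by linarith), ?_⟩
  rintro x' ⟨D, hD⟩
  refine ⟨2 ^ (y / (1 + ε)) * D, fun I hI => ?_⟩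
  have hε1 : 0 < y / (1 + ε) := by positivity
  have key : powMean (avgMeasure I) (y / (1 + ε)) f ≤
      2 ^ (y / (1 + ε)) * powMean (avgMeasure I) y f := by
    have h1 := ENNReal.rpow_le_rpow (hrh I hI) hε1.le
    simp_rw [← ENNReal.rpow_mul] at h1
    rw [ENNReal.mul_rpow_of_nonneg _ _ hε1.le, ← ENNReal.rpow_mul,
      mul_div_cancel₀ _ (by linarith : 1 + ε ≠ 0)] at h1
    rw [powMean, powMean, one_div_div]
    simpa only [one_div_mul_eq_div] using h1
  calc _ ≤ powMean (avgMeasure I) x' (fun a => (f a)⁻¹) *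
        (2 ^ (y / (1 + ε)) * powMean (avgMeasure I) y f) := mul_le_mul' le_rfl key
    _ = 2 ^ (y / (1 + ε)) *
        (powMean (avgMeasure I) x' (fun a => (f a)⁻¹) * powMean (avgMeasure I) y f) := by ring
    _ ≤ 2 ^ (y / (1 + ε)) * D := mul_le_mul' le_rfl (hD I hI)
    _ = _ := by rw [ENNReal.coe_mul, ENNReal.coe_rpow_of_nonneg _ hε1.le]; rfl

/-! ### Weight classes as two-sided conditions -/

theorem avg_rpow_eq_lintegral {w : UnitAddCircle → ℝ} (hw : ∀ᵐ x, 0 < w x)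
    (I : Set UnitAddCircle) (c : ℝ) :
    avg I (fun x => w x ^ c) = ∫⁻ x, ENNReal.ofReal (w x) ^ c ∂avgMeasure I := by
  rw [avg_eq_lintegral]
  refine lintegral_congr_ae ?_
  filter_upwards [(avgMeasure_absolutelyContinuous I).ae_le hw] with x hx
  rw [ENNReal.ofReal_rpow_of_pos hx]

theorem avg_neg_rpow_eq_lintegral {w : UnitAddCircle → ℝ} (hw : ∀ᵐ x, 0 < w x)
    (I : Set UnitAddCircle) (c : ℝ) :
    avg I (fun x => w x ^ (-c)) = ∫⁻ x, (ENNReal.ofReal (w x))⁻¹ ^ c ∂avgMeasure I := by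
  rw [avg_rpow_eq_lintegral hw]
  simp_rw [ENNReal.rpow_neg, ENNReal.inv_rpow]

theorem satisfiesAlpha_iff_twoSided {w : UnitAddCircle → ℝ} {p : ℝ} (h1 : 1 < p) (h2 : p < 2) :
    SatisfiesAlpha p w ↔
      IsWeight w ∧ TwoSided (fun x => ENNReal.ofReal (w x)) (p - 1) ((2 - p) / 2) := by
  unfold SatisfiesAlpha
  refine and_congr_right fun hw => ?_
  have hiff : ∀ I, avg I (fun x => w x ^ (-(1 / (p - 1)))) ^ (p - 1) *
      avg I (fun x => w x ^ (2 / (2 - p))) ^ ((2 - p) / 2) =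
      powMean (avgMeasure I) (p - 1) (fun a => (ENNReal.ofReal (w a))⁻¹) *
        powMean (avgMeasure I) ((2 - p) / 2) fun x => ENNReal.ofReal (w x) := fun I => by
    rw [avg_neg_rpow_eq_lintegral hw.2, avg_rpow_eq_lintegral hw.2, powMean, powMean, one_div_div]
  simp only [hiff, h1.ne', h2.ne, h1, h2, false_and, true_and, false_or]
  rfl

/-- An `A_1` weight satisfies every two-sided condition with second exponent `1`. -/
theorem SatisfiesA.twoSided_of_one {w : UnitAddCircle → ℝ} (h : SatisfiesA 1 w) {x : ℝ}
    (hx : 0 < x) : TwoSided (fun a => ENNReal.ofReal (w a)) x 1 := by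
  obtain ⟨hw, ⟨-, C, hC⟩ | ⟨h, -⟩⟩ := h
  swap
  · exact absurd h (lt_irrefl 1)
  refine ⟨C, fun I hI => ?_⟩
  have := hI.isProbabilityMeasure
  have hac := avgMeasure_absolutelyContinuous I
  have habs : avg I (fun y => |w y|) = ∫⁻ y, ENNReal.ofReal (w y) ∂avgMeasure I := by
    rw [avg_eq_lintegral]
    refine lintegral_congr_ae ?_
    filter_upwards [hac.ae_le hw.2] with y hy
    rw [abs_of_pos hy]
  have hmem : ∀ᵐ a ∂avgMeasure I, a ∈ I := by
    refine Measure.smul_absolutelyContinuous.ae_le ?_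
    obtain ⟨s, s', -, h2, rfl⟩ := hI
    exact ae_restrict_mem (measurableSet_arc h2)
  rw [powMean_one, mul_comm, ← powMean_const_mul hx
    (hw.isPosFinite.inv.aemeasurable.mono_ac hac), ← powMean_const (μ := avgMeasure I) hx C]
  refine powMean_mono hx ?_
  filter_upwards [hmem, hac.ae_le hC, hac.ae_le hw.2] with a haI haC hapos
  have hle : ∫⁻ y, ENNReal.ofReal (w y) ∂avgMeasure I ≤ C * ENNReal.ofReal (w a) := by
    rw [← habs]
    refine le_trans ?_ haC
    exact le_iSup_of_le I (le_iSup_of_le hI (le_iSup_of_le haI le_rfl))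
  calc _ ≤ C * ENNReal.ofReal (w a) * (ENNReal.ofReal (w a))⁻¹ := by gcongr
    _ = C := by
      rw [mul_assoc, ENNReal.mul_inv_cancel (ENNReal.ofReal_pos.2 hapos).ne'
        ENNReal.ofReal_ne_top, mul_one]

/-- Stated for `a⁻¹` because `a` enters the product with the negative exponent `1 - t`. The first
index is `1` for every `A_p`; for `p = 1` the condition is used in its `A_2` form. -/
theorem SatisfiesAInfty.exists_twoSided_inv {a : UnitAddCircle → ℝ} (h : SatisfiesAInfty a) :
    ∃ y, 0 < y ∧ TwoSided (fun x => (ENNReal.ofReal (a x))⁻¹) 1 y := by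
  obtain ⟨p, hp⟩ := h
  obtain ⟨rfl, -⟩ | ⟨h1, C, hC⟩ := hp.2
  · exact ⟨1, one_pos, (hp.twoSided_of_one one_pos).inv⟩
  · refine ⟨p - 1, sub_pos.2 h1, C, fun I hI => ?_⟩
    have := hC I hI
    rw [avg_neg_rpow_eq_lintegral hp.1.2, avg_eq_lintegral] at this
    simp only [inv_inv, powMean_one]
    exact this

/-- After raising `q` if `q = 1`, an `α_q` weight has an improved upper exponent. -/
theorem SatisfiesAlpha.exists_improved {q : ℝ} {w : UnitAddCircle → ℝ} (hq₁ : 1 ≤ q) (hq₂ : q < 2)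
    (hw : SatisfiesAlpha q w) : ∃ p y, 1 < p ∧ 0 < y ∧ y < (2 - p) / 2 ∧
      TwoSided (fun x => ENNReal.ofReal (w x)) (p - 1) y := by
  rcases hq₁.eq_or_lt with rfl | hq
  · obtain ⟨hw0, ⟨-, h⟩ | ⟨h, -⟩ | ⟨h, -⟩⟩ := hw
    · have hall : ∀ x, 0 < x → TwoSided (fun a => ENNReal.ofReal (w a)) x (1 / 2) := fun x hx => by
        have := (h.twoSided_of_one (x := 2 * x) (by linarith)).rpow (c := 1 / 2) (by norm_num)
        rw [show 1 / 2 * (2 * x) = x by ring, mul_one] at this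
        refine this.congr ?_
        filter_upwards [hw0.2] with a ha
        rw [ENNReal.ofReal_pow ha.le, ← ENNReal.rpow_natCast, ← ENNReal.rpow_mul]
        norm_num
      obtain ⟨y, hy0, hy, himp⟩ := (hall 1 one_pos).exists_lt hw0.isPosFinite one_pos (by norm_num)
      -- This `p` gives `(2 - p) / 2 = (1 / 2 + y) / 2`, the midpoint of `y` and `1 / 2`, hence
      -- above `y`.
      refine ⟨1 + (1 / 2 - y), y, by linarith, hy0, by linarith, himp _ (hall _ (by linarith))⟩
    · norm_num at h
    · exact absurd h (lt_irrefl 1)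
  · obtain ⟨hw0, h⟩ := (satisfiesAlpha_iff_twoSided hq hq₂).1 hw
    obtain ⟨y, hy0, hy, himp⟩ := h.exists_lt hw0.isPosFinite (by linarith) (by linarith)
    exact ⟨q, y, hq, hy0, hy, himp _ h⟩

/-- The whole circle is an arc, and `y ≤ 1` makes its finite mean of index `y` control the integral.
-/
theorem isWeight_of_twoSided {w : UnitAddCircle → ℝ} (hm : AEStronglyMeasurable w)
    (hpos : ∀ᵐ x, 0 < w x) {x y : ℝ} (hx : 0 < x) (hy : 0 < y) (hy1 : y ≤ 1)
    (h : TwoSided (fun a => ENNReal.ofReal (w a)) x y) : IsWeight w := by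
  have hf : IsPosFinite fun a => ENNReal.ofReal (w a) :=
    ⟨hm.aemeasurable.ennreal_ofReal, hpos.mono fun _ hx => ENNReal.ofReal_pos.2 hx,
      ae_of_all _ fun _ => ENNReal.ofReal_lt_top⟩
  have := (h.mono_right hf hy hy1).powMean_ne_top hf hx isArc_univ
  rw [powMean_one, avgMeasure_univ] at this
  refine ⟨⟨hm, ?_⟩, hpos⟩
  rw [hasFiniteIntegral_iff_ofReal (hpos.mono fun _ hx => hx.le)]
  exact this.lt_top

end CircleWeight

/-! ### Choice of `δ` and `r` -/

theorem lemma2 (q : ℝ) (hq₁ : 1 ≤ q) (hq₂ : q < 2) (w a : UnitAddCircle → ℝ)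
    (hw : CircleWeight.SatisfiesAlpha q w) (ha : CircleWeight.SatisfiesAInfty a) :
    ∃ δ : ℝ, 0 < δ ∧ δ < 1 ∧ ∀ t ∈ Set.Ioc (1 : ℝ) (1 + δ), ∃ r ∈ Set.Ioo t 2,
      CircleWeight.SatisfiesAlpha r (fun x => w x ^ t * a x ^ (1 - t)) := by
  have hw0 := hw.1
  obtain ⟨-, ha0, -⟩ := id ha
  obtain ⟨p, y, hp, hy0, hy, hwt⟩ := hw.exists_improved hq₁ hq₂
  obtain ⟨z, hz, hat⟩ := ha.exists_twoSided_inv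
  set d := (2 - p) / 2 - y with hd
  have hd0 : 0 < d := sub_pos.2 hy
  have hs : 0 < y + z + p / 2 := by linarith
  -- The required inequality `t * y + (t - 1) * z ≤ (2 - t * p) / 2` rearranges to `(t - 1) * (y + z
  -- + p / 2) ≤ d`. The `1 / 2` only ensures `δ < 1`.
  refine ⟨min (1 / 2) (d / (y + z + p / 2)), lt_min (by norm_num) (div_pos hd0 hs),
    (min_le_left _ _).trans_lt (by norm_num), fun t ht => ?_⟩
  have ht1 : 0 < t - 1 := sub_pos.2 ht.1
  have ht0 : 0 < t := by linarith
  have htd : (t - 1) * (y + z + p / 2) ≤ d := by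
    rw [← le_div_iff₀ hs]
    linarith [ht.2, min_le_right (1 / 2) (d / (y + z + p / 2))]
  have hexp : t * y + (t - 1) * z ≤ (2 - t * p) / 2 := by linarith
  have hexp0 : 0 < t * y + (t - 1) * z := by positivity
  have htp : t < t * p := lt_mul_of_one_lt_right ht0 hp
  -- The positive second index is at most `(2 - t * p) / 2`, which is therefore positive.
  have htp2 : t * p < 2 := by linarith
  refine ⟨t * p, ⟨htp, htp2⟩, ?_⟩
  have hpos : ∀ᵐ x, 0 < w x ^ t * a x ^ (1 - t) := by
    filter_upwards [hw0.2, ha0.2] with x h1 h2 using by positivity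
  have hwf := hw0.isPosFinite
  have haf := ha0.isPosFinite.inv
  have hmul := ((hwt.rpow ht0).mul (hwf.rpow ht0) (haf.rpow ht1) (hat.rpow ht1)
    (mul_pos ht0 (sub_pos.2 hp)) (by positivity) (by linarith) (by positivity)).mono_right
    ((hwf.rpow ht0).mul (haf.rpow ht1)) hexp0 hexp
  rw [show t * (p - 1) + (t - 1) * 1 = t * p - 1 by ring] at hmul
  have hts : CircleWeight.TwoSided (fun x => ENNReal.ofReal (w x ^ t * a x ^ (1 - t)))
      (t * p - 1) ((2 - t * p) / 2) := by
    refine hmul.congr ?_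
    filter_upwards [hw0.2, ha0.2] with x h1 h2
    rw [ENNReal.ofReal_mul (by positivity), ENNReal.ofReal_rpow_of_pos h1,
      ← ENNReal.ofReal_rpow_of_pos h2, ENNReal.inv_rpow, ← ENNReal.rpow_neg, neg_sub]
  refine (CircleWeight.satisfiesAlpha_iff_twoSided (by linarith [ht.1]) htp2).2 ⟨?_, hts⟩
  refine CircleWeight.isWeight_of_twoSided ?_ hpos (by linarith [ht.1]) (by linarith)
    (by linarith) hts
  exact ((hw0.1.aestronglyMeasurable.aemeasurable.pow_const t).mul
    (ha0.1.aestronglyMeasurable.aemeasurable.pow_const (1 - t))).aestronglyMeasurable
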